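/- Let $(R,\mathfrak m)$ be a complete Noetherian local domain of mixed characteristic $p>0$ ($p$ prime; that is, $R$ has characteristic $0$ and $R/pR$ has characteristic $p$), and let $R^+$ be its absolute integral closure, i.e. the integral closure of $R$ in an algebraic closure of its field of fractions. Let $p,x_2,\dots,x_d$ be a system of parameters of $R$, and let $B$ be a commutative $R^+$-algebra such that 1. $(p,x_2,\dots,x_d)B\neq B$; 2. $x_2,\dots,x_d$ is a regular sequence on $B/pB$; 3. $p$ is not nilpotent in $B$, and the ideal $(0:_B p)$ is annihilated by $p^{\epsilon}$ for every rational $\epsilon>0$ (for $\epsilon=m/n$ in lowest terms, $p^{\epsilon}\in R^+$ denotes an element with $(p^{\epsilon})^n=p^m$; it is unique up to a unit). Suppose that there is a function $v\colon B\to\mathbb R\cup\{\infty\}$, not identically equal to $\infty$, such that - $v(ab)=v(a)+v(b)$ for all $a,b\in B$; - $v(a+b)\ge\min\{v(a),v(b)\}$ for all $a,b\in B$; - $v(0)=\infty$; - $v(b)\ge 0$ for all $b\in B$, and $v(b)>0$ for every nonunit $b\in B$. Then $B$ maps to a big Cohen–Macaulay $R^+$-algebra: there are a commutative $R^+$-algebra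 $C$ with $\mathfrak mC\ne C$ on which $p,x_2,\dots,x_d$ is a regular sequence, and an $R^+$-algebra homomorphism $B\to C$. -/

import Mathlib

universe u w

/-- The absolute integral closure `R⁺` of a domain `R`: the integral closure of `R` in an algebraic
closure of its field of fractions. -/
abbrev AbsIntClosure (R : Type*) [CommRing R] [IsDomain R] : Type _ :=
  integralClosure R (AlgebraicClosure (FractionRing R))

/-- The list `xs` is a system of parameters of the local ring `R`: it consists of `dim R` elements
of the maximal ideal, and the ideal generated by them is primary to the maximal ideal. -/
structure IsSystemOfParams (R : Type*) [CommRing R] [IsLocalRing R] (xs : List R) : Prop where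
  length_eq : ringKrullDim R = (xs.length : WithBot ℕ∞)
  mem_maximalIdeal : ∀ x ∈ xs, x ∈ IsLocalRing.maximalIdeal R
  radical_eq : (Ideal.ofList xs).radical = IsLocalRing.maximalIdeal R

/-- The element `c` is a choice of the power `a ^ ε`, for a non-negative rational
number `ε = m / n` in lowest terms: `c ^ n = a ^ m`. -/
def IsRatPow {S : Type*} [CommRing S] (a : S) (ε : ℚ≥0) (c : S) : Prop :=
  c ^ ε.den = a ^ ε.num

/-- The `R⁺`-algebra `C` is big Cohen-Macaulay with respect to the system of
parameters `xs` of the local domain `R`: the maximal ideal of `R` does not expand to the unit ideal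
of `C`, and `xs` is a regular sequence on `C`. -/
structure IsBigCohenMacaulay (R : Type*) [CommRing R] [IsDomain R] [IsLocalRing R]
    (xs : List R) (C : Type*) [CommRing C] [Algebra (AbsIntClosure R) C] : Prop where
  isSystemOfParams : IsSystemOfParams R xs
  map_maximalIdeal_ne_top :
    (IsLocalRing.maximalIdeal R).map
      ((algebraMap (AbsIntClosure R) C).comp (algebraMap R (AbsIntClosure R))) ≠ ⊤
  isRegular : RingTheory.Sequence.IsRegular C (xs.map (algebraMap R (AbsIntClosure R)))

/-!
The valuation is needed only to make `B` local: an element is a unit exactly when its value is `0`,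
so by multiplicativity and the ultrametric inequality the nonunits are closed under addition
(`isLocalRing_of_valuation`).

The algebra `C` is then obtained by Gabber's trick of localizing an infinite power. Choose `c n` in
`R⁺` with `c n ^ (n + 1) = p` and `c n` killing `(0 :_B p)`, and put
`C = (ℕ → B)[1 / (c 0, c 1, …)]`. An element of `ℕ → B` lies in a finitely generated ideal
extended from `B` as soon as all its components do, so `x₂, …, x_d` remains regular modulo `p`. If
`p b = 0` in `ℕ → B`, then `c n` kills the `n`-th component of `b`, so `b` dies in `C`; hence
`p, x₂, …, x_d` is weakly regular on `C` (`isWeaklyRegular_localization`).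

It remains to see that `(p, x₂, …, x_d) C ≠ C`. Otherwise some power `(c n) ^ m`, with `m`
independent of `n`, lies in `(p, x₂, …, x_d) B` for all `n`. Take `n = m`. As `c n` is a nonunit of
the local ring `B` and `p = (c n) ^ m * c n`, the factor `1 - c n * a` is always a unit, so
`(c n) ^ m`, and with it `p`, already lies in `(x₂, …, x_d) B`. But the regularity of
`x₂, …, x_d` on `B / pB` lets `p` be cancelled modulo `(x₂, …, x_d) B` up to `p`-torsion
(`mem_torsion_sup_ofList`), so `1 ∈ (0 :_B p) + (x₂, …, x_d) B`. By locality `(0 :_B p) = B`, that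
is, `p = 0` in `B`, which is excluded (`pow_notMem_ofList_cons`).
-/

open RingTheory.Sequence

theorem mem_ofList_cons {A : Type*} [CommRing A] {y : A} {ys : List A} {a : A} :
    a ∈ Ideal.ofList (y :: ys) ↔ ∃ b, a - y * b ∈ Ideal.ofList ys := by
  rw [Ideal.ofList_cons, Submodule.mem_sup]
  constructor
  · rintro ⟨s, hs, t, ht, rfl⟩
    obtain ⟨b, rfl⟩ := Ideal.mem_span_singleton'.1 hs
    exact ⟨b, by simpa [mul_comm] using ht⟩
  · rintro ⟨b, hb⟩
    exact ⟨y * b, Ideal.mul_mem_right _ _ (Ideal.mem_span_singleton_self y), _, hb, by ring⟩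

theorem isWeaklyRegular_self_iff {A : Type*} [CommRing A] (ys : List A) :
    IsWeaklyRegular A ys ↔ ∀ i (h : i < ys.length) (a : A),
      ys[i] * a ∈ Ideal.ofList (ys.take i) → a ∈ Ideal.ofList (ys.take i) := by
  rw [isWeaklyRegular_iff]
  refine forall₂_congr fun i h => ?_
  rw [isSMulRegular_quotient_iff_mem_of_smul_mem]
  simp only [smul_eq_mul, Ideal.mul_top]

theorem isWeaklyRegular_quotient_span_iff {A : Type*} [CommRing A] (y : A) (ys : List A) :
    IsWeaklyRegular (A ⧸ Ideal.span {y}) ys ↔ ∀ i (h : i < ys.length) (a : A),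
      ys[i] * a ∈ Ideal.ofList (y :: ys.take i) → a ∈ Ideal.ofList (y :: ys.take i) := by
  rw [isWeaklyRegular_iff]
  refine forall₂_congr fun i h => ?_
  have key (a : A) : Submodule.mkQ (Ideal.span {y}) a ∈
      (Ideal.ofList (ys.take i) • ⊤ : Submodule A (A ⧸ Ideal.span {y})) ↔
      a ∈ Ideal.ofList (y :: ys.take i) := by
    rw [← Submodule.range_mkQ, LinearMap.range_eq_map, ← Submodule.map_smul'',
      ← Submodule.mem_comap, Submodule.comap_map_mkQ, smul_eq_mul, Ideal.mul_top,
      Ideal.ofList_cons]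
  rw [isSMulRegular_quotient_iff_mem_of_smul_mem, (Submodule.mkQ_surjective _).forall]
  refine forall_congr' fun a => ?_
  rw [← map_smul, key, key, smul_eq_mul]

theorem mem_map_ofList_pi {A ι : Type*} [CommRing A] (ys : List A) (f : ι → A) :
    f ∈ (Ideal.ofList ys).map (algebraMap A (ι → A)) ↔ ∀ i, f i ∈ Ideal.ofList ys := by
  rw [Ideal.map_ofList]
  induction ys generalizing f with
  | nil => simp [funext_iff]
  | cons y ys ih =>
    simp only [List.map_cons, mem_ofList_cons, ih]
    exact ⟨fun ⟨b, hb⟩ i => ⟨b i, hb i⟩, fun h => Classical.skolem.1 h⟩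

/-- A valuation-like function with values in `[0, ∞]` that is positive on the nonunits forces the
ring to be local. -/
theorem isLocalRing_of_valuation {B : Type*} [CommRing B] (v : B → WithTop ℝ)
    (hv_mul : ∀ a b : B, v (a * b) = v a + v b)
    (hv_add : ∀ a b : B, min (v a) (v b) ≤ v (a + b)) (hv_zero : v 0 = ⊤)
    (hv_nonneg : ∀ b : B, 0 ≤ v b) (hv_pos : ∀ b : B, ¬ IsUnit b → 0 < v b)
    (hv_ne_top : ∃ b : B, v b ≠ ⊤) : IsLocalRing B := by
  obtain ⟨b, hb⟩ := hv_ne_top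
  have h1 : v 1 = 0 := by
    have h := hv_mul 1 b
    rw [one_mul] at h
    exact (WithTop.add_right_inj hb).1 (h.symm.trans (zero_add _).symm)
  have hunit : ∀ u : B, IsUnit u → v u = 0 := by
    intro u hu
    obtain ⟨w, hw⟩ := hu.exists_right_inv
    have h := hv_mul u w
    rw [hw, h1] at h
    exact le_antisymm (h ▸ le_add_of_nonneg_right (hv_nonneg w)) (hv_nonneg u)
  have : Nontrivial B := ⟨1, 0, fun h => by simp [h, hv_zero] at h1⟩
  refine IsLocalRing.of_nonunits_add fun a b ha hb h => ?_
  exact ((lt_min (hv_pos a ha) (hv_pos b hb)).trans_le (hv_add a b)).ne' (hunit _ h)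

/-- If `ys` is regular modulo `p`, then multiplication by `p` is injective modulo `ys` up to
`p`-torsion. This is the fact that the first element of a regular sequence may be moved to the
end, for a `p` that is allowed to have torsion. -/
theorem mem_torsion_sup_ofList {B : Type*} [CommRing B] {p : B} {ys : List B}
    (hreg : IsWeaklyRegular (B ⧸ Ideal.span {p}) ys) {z : B} (hz : p * z ∈ Ideal.ofList ys) :
    ∃ t, p * t = 0 ∧ z - t ∈ Ideal.ofList ys := by
  rw [isWeaklyRegular_quotient_span_iff] at hreg
  suffices H : ∀ k ≤ ys.length, ∀ z, p * z ∈ Ideal.ofList (ys.take k) →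
      ∃ t, p * t = 0 ∧ z - t ∈ Ideal.ofList (ys.take k) by
    simpa using H ys.length le_rfl z (by simpa using hz)
  intro k
  induction k with
  | zero => exact fun _ z hz => ⟨z, by simpa using hz, by simp⟩
  | succ k ih =>
    intro hk z hz
    have hmem (a : B) : a ∈ Ideal.ofList (ys.take (k + 1)) ↔
        ∃ w, a - ys[k] * w ∈ Ideal.ofList (ys.take k) := by
      rw [← mem_ofList_cons, ← List.take_concat_get' ys k hk, Ideal.ofList_append,
        Ideal.ofList_singleton, sup_comm, ← Ideal.ofList_cons]
    obtain ⟨w, hw⟩ := (hmem _).1 hz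
    -- `ys[k] * w` vanishes modulo `p` and the previous elements, hence so does `w`
    obtain ⟨w', hw'⟩ := mem_ofList_cons.1 <| hreg k hk w <|
      mem_ofList_cons.2 ⟨z, by simpa using neg_mem hw⟩
    obtain ⟨t, ht, hzt⟩ := ih (by lia) (z - ys[k] * w') <| by
      have := add_mem hw (Ideal.mul_mem_left _ ys[k] hw')
      ring_nf at this ⊢
      exact this
    exact ⟨t, ht, (hmem _).2 ⟨w', by rwa [sub_right_comm]⟩⟩

/-- In a local ring in which `ys` is regular modulo `p ≠ 0`, a fractional power of `p` with exponent
less than `1` lies outside `(p, ys)`. -/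
theorem pow_notMem_ofList_cons {B : Type*} [CommRing B] [IsLocalRing B] {p : B} {ys : List B}
    (hreg : IsWeaklyRegular (B ⧸ Ideal.span {p}) ys) (hp : p ≠ 0)
    (hproper : Ideal.ofList (p :: ys) ≠ ⊤) {c : B} {m : ℕ} (hc : c ^ (m + 1) = p) :
    c ^ m ∉ Ideal.ofList (p :: ys) := by
  intro hmem
  have hle : Ideal.ofList (p :: ys) ≤ IsLocalRing.maximalIdeal B :=
    IsLocalRing.le_maximalIdeal hproper
  have hle' : Ideal.ofList ys ≤ IsLocalRing.maximalIdeal B :=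
    le_trans (by rw [Ideal.ofList_cons]; exact le_sup_right) hle
  have hcm : c ∈ IsLocalRing.maximalIdeal B := by
    refine Ideal.IsPrime.mem_of_pow_mem inferInstance (m + 1) (hle ?_)
    rw [hc, Ideal.ofList_cons]
    exact Ideal.mem_sup_left (Ideal.mem_span_singleton_self p)
  obtain ⟨a, ha⟩ := mem_ofList_cons.1 hmem
  have hu : IsUnit (1 - c * a) :=
    IsLocalRing.isUnit_one_sub_self_of_mem_nonunits _ (Ideal.mul_mem_right a _ hcm)
  have hcys : c ^ m ∈ Ideal.ofList ys := by
    refine (Ideal.mul_unit_mem_iff_mem _ hu).1 ?_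
    rw [← hc] at ha
    ring_nf at ha ⊢
    exact ha
  have hpys : p * 1 ∈ Ideal.ofList ys := by
    rw [mul_one, ← hc, pow_succ]
    exact Ideal.mul_mem_right _ _ hcys
  obtain ⟨t, ht, h1t⟩ := mem_torsion_sup_ofList hreg hpys
  have htu : IsUnit t := by
    simpa using IsLocalRing.isUnit_one_sub_self_of_mem_nonunits _ (hle' h1t)
  exact hp ((IsUnit.mul_left_eq_zero htu).1 ht)

theorem algebraMap_mem_map_ofList_iff {B ι : Type*} [CommRing B] (c f : ι → B) (zs : List B) :
    algebraMap (ι → B) (Localization.Away c) f ∈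
        (Ideal.ofList zs).map (algebraMap B (Localization.Away c)) ↔
      ∃ k : ℕ, ∀ i, c i ^ k * f i ∈ Ideal.ofList zs := by
  rw [IsScalarTower.algebraMap_eq B (ι → B) (Localization.Away c), ← Ideal.map_map,
    IsLocalization.algebraMap_mem_map_algebraMap_iff (Submonoid.powers c)]
  simp only [Submonoid.mem_powers_iff, exists_exists_eq_and, mem_map_ofList_pi, Pi.mul_apply,
    Pi.pow_apply]

/-- Gabber's trick: inverting a family `c` in `ι → B` each of whose members kills the `p`-torsion
of `B` makes `p` a nonzerodivisor and keeps `ys` regular modulo `p`. -/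
theorem isWeaklyRegular_localization {B ι : Type*} [CommRing B] {p : B} {ys : List B}
    (hreg : IsWeaklyRegular (B ⧸ Ideal.span {p}) ys) {c : ι → B}
    (hc : ∀ i b, p * b = 0 → c i * b = 0) :
    IsWeaklyRegular (Localization.Away c) (p :: ys) := by
  rw [isWeaklyRegular_quotient_span_iff] at hreg
  rw [← isWeaklyRegular_map_algebraMap_iff (Localization.Away c), isWeaklyRegular_self_iff]
  intro i hi a ha
  -- replace `a` by its numerator
  obtain ⟨f, s, rfl⟩ := IsLocalization.exists_mk'_eq (Submonoid.powers c) a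
  rw [← List.map_take, ← Ideal.map_ofList] at ha ⊢
  rw [IsLocalization.mk'_mem_iff, algebraMap_mem_map_ofList_iff]
  rw [List.getElem_map, IsScalarTower.algebraMap_apply B (ι → B),
    IsLocalization.mul_mk'_eq_mk'_of_mul, IsLocalization.mk'_mem_iff, algebraMap_mem_map_ofList_iff] at ha
  obtain ⟨k, hk⟩ := ha
  cases i with
  | zero =>
    refine ⟨k + 1, fun j => ?_⟩
    have h := hk j
    simp only [List.take_zero, Ideal.ofList_nil, Ideal.mem_bot] at h ⊢
    rw [pow_succ', mul_assoc]
    exact hc j _ (by rw [← h]; simp; ring)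
  | succ i =>
    refine ⟨k, fun j => hreg i (by simpa using hi) _ ?_⟩
    have h := hk j
    simp only [Pi.mul_apply, Pi.algebraMap_apply, Algebra.algebraMap_self, RingHom.id_apply] at h
    rwa [mul_left_comm] at h

/-- If an ideal with radical `I` extends to a proper ideal, then so does `I`. -/
theorem map_ne_top_of_radical_eq {R C : Type*} [CommRing R] [IsNoetherianRing R] [CommRing C]
    (f : R →+* C) {I J : Ideal R} (h : J.radical = I) (hJ : J.map f ≠ ⊤) : I.map f ≠ ⊤ := by
  intro hI
  obtain ⟨k, hk⟩ := Ideal.exists_radical_pow_le_of_fg J (IsNoetherian.noetherian _)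
  apply hJ
  rw [eq_top_iff, ← Ideal.top_pow C k, ← hI, ← h, ← Ideal.map_pow]
  exact Ideal.map_mono hk

theorem corollary6p2
    -- a complete Noetherian local domain of mixed characteristic `p`
    {R : Type u} [CommRing R] [IsDomain R] [IsLocalRing R] [IsNoetherianRing R]
    [IsAdicComplete (IsLocalRing.maximalIdeal R) R]
    (p : ℕ) (hp : p.Prime) [CharZero R] [CharP (R ⧸ Ideal.span {(p : R)}) p]
    -- a system of parameters `p, x₂, …, x_d`
    (xs : List R) (hxs : IsSystemOfParams R ((p : R) :: xs))
    {B : Type w} [CommRing B] [Algebra (AbsIntClosure R) B]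
    -- `(p, x₂, …, x_d) B ≠ B`
    (hB_proper : (Ideal.ofList ((p : R) :: xs)).map
      ((algebraMap (AbsIntClosure R) B).comp (algebraMap R (AbsIntClosure R))) ≠ ⊤)
    -- `x₂, …, x_d` is a regular sequence on `B / p B`
    (hB_regular : RingTheory.Sequence.IsRegular (B ⧸ Ideal.span {(p : B)})
      (xs.map (algebraMap R (AbsIntClosure R))))
    -- `p` is not nilpotent in `B`, and `p ^ ε` kills `(0 :_B p)` for all rational `ε > 0`
    (hB_not_nilp : ¬ IsNilpotent (p : B))
    (hB_almost : ∀ ε : ℚ≥0, 0 < ε → ∃ c : AbsIntClosure R,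
      IsRatPow (p : AbsIntClosure R) ε c ∧ ∀ b : B, (p : B) * b = 0 → c • b = 0)
    -- the pseudo-valuation, not identically `∞`
    (v : B → WithTop ℝ)
    (hv_mul : ∀ a b : B, v (a * b) = v a + v b)
    (hv_add : ∀ a b : B, min (v a) (v b) ≤ v (a + b))
    (hv_zero : v 0 = ⊤)
    (hv_nonneg : ∀ b : B, 0 ≤ v b)
    (hv_pos : ∀ b : B, ¬ IsUnit b → 0 < v b)
    (hv_ne_top : ∃ b : B, v b ≠ ⊤) :
    ∃ (C : Type w) (_ : CommRing C) (_ : Algebra (AbsIntClosure R) C),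
      IsBigCohenMacaulay R ((p : R) :: xs) C ∧ Nonempty (B →ₐ[AbsIntClosure R] C) := by
  have := isLocalRing_of_valuation v hv_mul hv_add hv_zero hv_nonneg hv_pos hv_ne_top
  have hroot (n : ℕ) : ∃ c : AbsIntClosure R, c ^ (n + 1) = p ∧
      ∀ b : B, (p : B) * b = 0 → c • b = 0 := by
    obtain ⟨c, hc, hcb⟩ := hB_almost ((n + 1 : ℕ) : ℚ≥0)⁻¹ (by positivity)
    refine ⟨c, ?_, hcb⟩
    have hne : ((n + 1 : ℕ) : ℚ≥0) ≠ 0 := by positivity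
    rwa [IsRatPow, NNRat.den_inv_of_ne_zero hne, NNRat.num_inv_of_ne_zero hne, NNRat.num_natCast,
      NNRat.den_natCast, pow_one] at hc
  choose r hr hrtors using hroot
  let c : ℕ → B := fun n => algebraMap _ B (r n)
  have hc (n : ℕ) : c n ^ (n + 1) = p := by
    rw [← map_pow, hr, map_natCast]
  let ys : List B := xs.map ((algebraMap (AbsIntClosure R) B).comp (algebraMap R (AbsIntClosure R)))
  have hreg : IsWeaklyRegular (B ⧸ Ideal.span {(p : B)}) ys := by
    have h := hB_regular.toIsWeaklyRegular
    rwa [← isWeaklyRegular_map_algebraMap_iff B, List.map_map] at h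
  have hmap : ((p : R) :: xs).map
      ((algebraMap (AbsIntClosure R) B).comp (algebraMap R (AbsIntClosure R))) = (p : B) :: ys := by
    rw [List.map_cons, map_natCast]
  have hproper : Ideal.ofList ((p : B) :: ys) ≠ ⊤ := by
    rwa [Ideal.map_ofList, hmap] at hB_proper
  have hp0 : (p : B) ≠ 0 := fun h => hB_not_nilp (h ▸ IsNilpotent.zero)
  have hCproper : (Ideal.ofList ((p : R) :: xs)).map
      ((algebraMap (AbsIntClosure R) (Localization.Away c)).comp
        (algebraMap R (AbsIntClosure R))) ≠ ⊤ := by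
    rw [IsScalarTower.algebraMap_eq (AbsIntClosure R) B, RingHom.comp_assoc, ← Ideal.map_map,
      Ideal.map_ofList, hmap, Ne, Ideal.eq_top_iff_one,
      ← map_one (algebraMap (ℕ → B) (Localization.Away c)), algebraMap_mem_map_ofList_iff]
    rintro ⟨m, hm⟩
    -- the exponent `m` is the same for all components; the component `m` contradicts it
    exact pow_notMem_ofList_cons hreg hp0 hproper (hc m) (by simpa using hm m)
  refine ⟨Localization.Away c, inferInstance, inferInstance, ⟨hxs, ?_, ⟨?_, ?_⟩⟩,
    ⟨IsScalarTower.toAlgHom _ B _⟩⟩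
  · exact map_ne_top_of_radical_eq _ hxs.radical_eq hCproper
  · rw [← isWeaklyRegular_map_algebraMap_iff B, List.map_map]
    have h := isWeaklyRegular_localization hreg (c := c) fun n b hb => by
      rw [← hrtors n b hb, Algebra.smul_def]
    rwa [← hmap] at h
  · intro h
    apply hCproper
    rw [← Ideal.map_map, Ideal.map_ofList (algebraMap R _)]
    rw [Ideal.smul_top_eq_map] at h
    exact (Submodule.restrictScalars_eq_top_iff _ _ _).1 h.symm
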